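/- The VC-dimension of a finite graph $G=(V,E)$ is the largest integer $k$ for which there is a $k$-element set $S\subseteq V$ such that every subset of $S$ has the form $S\cap N(v)$ for some $v\in V$, where $N(v)$ is the set of neighbours of $v$ (so $v\notin N(v)$). For integers $d,n,s$ and real $m$, let $\mathbf{RT}_d(n,K_s,m)$ be the maximum number of edges of an $n$-vertex $K_s$-free graph of VC-dimension at most $d$ with independence number at most $m$ (and $0$ if there is no such graph). Write $\mathbf{RT}_d(n,K_s,o(n))=g(n)+o(n^2)$ if $\mathbf{RT}_d(n,K_s,f(n))\le g(n)+o(n^2)$ for every function $f(n)=o(n)$, and $\mathbf{RT}_d(n,K_s,f(n))=g(n)+o(n^2)$ for some function $f(n)=o(n)$. Theorem 5. For all fixed integers $d\ge 4$ and $p\ge 3$, the Ramsey–Turán numbers for $K_{2p-1}$ and for $K_{2p}$ have the same asymptotics: $$\mathbf{RT}_d(n,K_{2p-1},o(n))=\frac12\Bigl(1-\frac1{p-1}\Bigr)n^2+o(n^2)\quad\text{and}\quad \mathbf{RT}_d(n,K_{2p},o(n))=\frac12\Bigl(1-\frac1{p-1}\Bigr)n^2+o(n^2).$$ Moreover, for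 every $\varepsilon>0$ there is a constant $\gamma=\gamma(d,p,\varepsilon)>0$ such that, for every $n$, every $n$-vertex $K_{2p}$-free graph of VC-dimension at most $d$ with more than $\frac12\bigl(1-\frac1{p-1}+\varepsilon\bigr)n^2$ edges contains an independent set of size at least $\gamma n$. -/

import Mathlib

open Filter Asymptotics

namespace RamseyTuran

open Classical in
/-- The VC-dimension of a finite graph: the VC-dimension of the set system
`{N(v) : v ∈ V}` of the (open) neighbourhoods of its vertices. -/
noncomputable def graphVCDim {V : Type*} [Fintype V] (G : SimpleGraph V) : ℕ :=
  (Finset.univ.image fun v : V => G.neighborFinset v).vcDim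

/-- `G` is admissible for `RT_d(n, K_s, m)`: it is `K_s`-free, has VC-dimension at most `d`,
and its independence number is at most `m`. -/
structure Admissible (d s : ℕ) (m : ℝ) {n : ℕ} (G : SimpleGraph (Fin n)) : Prop where
  cliqueFree : G.CliqueFree s
  vcDim_le : graphVCDim G ≤ d
  indepNum_le : (G.indepNum : ℝ) ≤ m

/-- `RT_d(n, K_s, m)`: the maximum number of edges of an `n`-vertex `K_s`-free graph of
VC-dimension at most `d` and independence number at most `m`
(the set is finite; the value is `0` if there is no such graph). -/
noncomputable def RT (d n s : ℕ) (m : ℝ) : ℕ :=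
  sSup {e : ℕ | ∃ G : SimpleGraph (Fin n), Admissible d s m G ∧ G.edgeSet.ncard = e}

/-- `RT_d(n, K_s, o(n)) = g(n) + o(n²)`: for every function `f(n) = o(n)` one has
`RT_d(n, K_s, f(n)) ≤ g(n) + o(n²)`, and for some function `f(n) = o(n)` one has
`RT_d(n, K_s, f(n)) = g(n) + o(n²)`. -/
def RTLittleOEq (d s : ℕ) (g : ℕ → ℝ) : Prop :=
  (∀ f : ℕ → ℝ, (f =o[atTop] fun n : ℕ => (n : ℝ)) →
    ∀ ε : ℝ, 0 < ε → ∀ᶠ n : ℕ in atTop, (RT d n s (f n) : ℝ) ≤ g n + ε * (n : ℝ) ^ 2) ∧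
  (∃ f : ℕ → ℝ, (f =o[atTop] fun n : ℕ => (n : ℝ)) ∧
    (fun n : ℕ => (RT d n s (f n) : ℝ) - g n) =o[atTop] fun n : ℕ => (n : ℝ) ^ 2)

end RamseyTuran

/-!
The upper bound. In a graph of VC-dimension at most `d`, a random sample of boundedly many vertices
distinguishes any family of vertices whose neighbourhoods pairwise differ substantially, so by the
Sauer–Shelah lemma such a family is bounded (`exists_packing_bound`). Hence the vertices split into
boundedly many classes of vertices with almost equal neighbourhoods (`exists_nbrDiff_partition`).
Replacing the endpoints of an edge by random members of their classes then rarely destroys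
adjacency, so almost every edge lies between two classes that are almost completely joined
(`card_sparseEdges_le`). Deleting the other edges, and those at small classes, leaves a graph still
denser than the Turán graph with `p - 1` parts, so Turán's theorem gives a `K_p`, and therewith `p`
large classes that are pairwise almost completely joined. If every set of linear size spans an edge,
one can choose an edge in each of these classes, one class after the other, so that all the
endpoints are adjacent (`exists_isNClique_of_nearly_complete`). This is a `K_{2p}`, so a
`K_{2p}`-free graph has a linear-sized independent set (`exists_linear_isIndepSet`).

The lower bound. Let `H` be a triangle-free graph on `n` vertices without 4-cycles and with
independence number `O(n ^ (3 / 4))`. The union of `H` and the Turán graph with `p - 1` parts has no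
`K_{2p-1}`, since a part contains at most two vertices of a clique, and its VC-dimension is at most
`3`, because four shattered vertices would give a 4-cycle in `H` within one part
(`graphVCDim_turanGraph_sup_le`). Such an `H` is found explicitly, inside the graph on `F_q × F_q`
in which `(a, x)` and `(b, y)` are adjacent when `x + y = (a - b) ^ 2` (`exists_girth_five_graph`).
Two points have at most one common neighbour there, which excludes 4-cycles and, by a second-moment
argument, independent sets larger than `q ^ (3 / 2)`. In a triangle the product of the three values
`-x` is a square, so keeping only points with `-x` a non-square removes all triangles.
-/

namespace RamseyTuran

/-! ### Shattered vertex sets and packings of neighbourhoods -/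

section Packing

variable {V : Type*} [Fintype V]

theorem card_le_graphVCDim (G : SimpleGraph V) (S : Finset V)
    (h : ∀ t ⊆ S, ∃ v, ∀ x ∈ S, G.Adj v x ↔ x ∈ t) : S.card ≤ graphVCDim G := by
  classical
  unfold graphVCDim
  refine Finset.Shatters.card_le_vcDim fun t ht ↦ ?_
  obtain ⟨v, hv⟩ := h t ht
  refine ⟨_, Finset.mem_image_of_mem _ (Finset.mem_univ v), ?_⟩
  ext x
  simp only [Finset.mem_inter, SimpleGraph.mem_neighborFinset]
  exact ⟨fun hx ↦ (hv x hx.1).1 hx.2, fun hx ↦ ⟨ht hx, (hv x (ht hx)).2 hx⟩⟩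

theorem graphVCDim_le (G : SimpleGraph V) (k : ℕ)
    (h : ∀ S : Finset V, (∀ t ⊆ S, ∃ v, ∀ x ∈ S, G.Adj v x ↔ x ∈ t) → S.card ≤ k) :
    graphVCDim G ≤ k := by
  classical
  unfold graphVCDim Finset.vcDim
  refine Finset.sup_le fun S hS ↦ h S fun t ht ↦ ?_
  rw [Finset.mem_shatterer] at hS
  obtain ⟨u, hu, hut⟩ := hS ht
  obtain ⟨v, -, rfl⟩ := Finset.mem_image.1 hu
  refine ⟨v, fun x hx ↦ ?_⟩
  rw [← hut]
  simp [hx]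

open Classical in
/-- The set of vertices adjacent to exactly one of `u` and `v`: the symmetric difference of the
two neighbourhoods. -/
noncomputable def nbrDiff (G : SimpleGraph V) (u v : V) : Finset V :=
  {w | ¬(G.Adj u w ↔ G.Adj v w)}

theorem mem_nbrDiff {G : SimpleGraph V} {u v w : V} :
    w ∈ nbrDiff G u v ↔ ¬(G.Adj u w ↔ G.Adj v w) := by
  simp [nbrDiff]

theorem nbrDiff_comm (G : SimpleGraph V) (u v : V) : nbrDiff G u v = nbrDiff G v u := by
  ext w
  rw [mem_nbrDiff, mem_nbrDiff]
  tauto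

theorem nbrDiff_self (G : SimpleGraph V) (u : V) : nbrDiff G u u = ∅ := by
  ext w
  simp [mem_nbrDiff]

theorem card_nbrDiff_triangle (G : SimpleGraph V) (u v w : V) :
    (nbrDiff G u w).card ≤ (nbrDiff G u v).card + (nbrDiff G v w).card := by
  classical
  refine (Finset.card_le_card fun x hx ↦ ?_).trans (Finset.card_union_le _ _)
  rw [Finset.mem_union, mem_nbrDiff, mem_nbrDiff]
  rw [mem_nbrDiff] at hx
  tauto

/-- Sauer–Shelah for the traces of neighbourhoods on a sample `φ` of `m` vertices (with
repetitions): if the sample distinguishes the members of `C`, then `C` has polynomial size. -/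
theorem card_le_of_separated {d m : ℕ} (G : SimpleGraph V) (hG : graphVCDim G ≤ d)
    (C : Finset V) (φ : Fin m → V)
    (hφ : ∀ u ∈ C, ∀ v ∈ C, u ≠ v → ∃ i, φ i ∈ nbrDiff G u v) :
    C.card ≤ (d + 1) * (m + 1) ^ d := by
  classical
  let T : V → Finset (Fin m) := fun v ↦ {i | G.Adj v (φ i)}
  have hT : ∀ v i, i ∈ T v ↔ G.Adj v (φ i) := fun v i ↦ by simp [T]
  have hinj : Set.InjOn T C := by
    intro u hu v hv huv
    by_contra hne
    obtain ⟨i, hi⟩ := hφ u hu v hv hne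
    rw [mem_nbrDiff, ← hT, ← hT, huv] at hi
    exact hi Iff.rfl
  have hvc : (C.image T).vcDim ≤ d := by
    refine Finset.sup_le fun S hS ↦ ?_
    rw [Finset.mem_shatterer] at hS
    -- Shattered sample points are distinct vertices, since some trace separates them.
    have hφS : Set.InjOn φ S := by
      intro i hi j hj hij
      obtain ⟨u, hu, huS⟩ := hS (Finset.singleton_subset_iff.2 hi)
      obtain ⟨v, -, rfl⟩ := Finset.mem_image.1 hu
      have h1 : i ∈ S ∩ T v := by rw [huS]; simp
      have h2 : j ∈ S ∩ T v := by
        rw [Finset.mem_inter, hT, ← hij, ← hT]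
        exact ⟨hj, (Finset.mem_inter.1 h1).2⟩
      rw [huS, Finset.mem_singleton] at h2
      exact h2.symm
    rw [← Finset.card_image_of_injOn hφS]
    refine (card_le_graphVCDim G _ fun t _ ↦ ?_).trans hG
    obtain ⟨u, hu, huS⟩ := hS (Finset.filter_subset (fun i ↦ φ i ∈ t) S)
    obtain ⟨v, -, rfl⟩ := Finset.mem_image.1 hu
    refine ⟨v, fun x hx ↦ ?_⟩
    obtain ⟨i, hi, rfl⟩ := Finset.mem_image.1 hx
    have := Finset.ext_iff.1 huS i
    rw [Finset.mem_inter, hT, Finset.mem_filter] at this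
    exact ⟨fun h ↦ (this.1 ⟨hi, h⟩).2, fun h ↦ (this.2 ⟨hi, h⟩).2⟩
  calc C.card = (C.image T).card := (Finset.card_image_of_injOn hinj).symm
    _ ≤ (C.image T).shatterer.card := Finset.card_le_card_shatterer _
    _ ≤ ∑ k ∈ Finset.Iic (C.image T).vcDim, (Fintype.card (Fin m)).choose k :=
        Finset.card_shatterer_le_sum_vcDim
    _ ≤ ∑ k ∈ Finset.Iic d, (Fintype.card (Fin m)).choose k :=
        Finset.sum_le_sum_of_subset (Finset.Iic_subset_Iic.2 hvc)
    _ ≤ ∑ k ∈ Finset.Iic d, (m + 1) ^ d := by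
        refine Finset.sum_le_sum fun k hk ↦ ?_
        rw [Fintype.card_fin]
        calc m.choose k ≤ m ^ k := Nat.choose_le_pow m k
          _ ≤ (m + 1) ^ k := Nat.pow_le_pow_left (Nat.le_succ m) k
          _ ≤ (m + 1) ^ d := Nat.pow_le_pow_right (Nat.succ_pos m) (Finset.mem_Iic.1 hk)
    _ = (d + 1) * (m + 1) ^ d := by simp

/-- A union bound over samples: if every two members of `C` are distinguished by at least a
`δ`-fraction of all vertices and `m` is large, some sample of `m` vertices distinguishes all pairs
in `C`. -/
theorem exists_separating_sample {δ : ℝ} {m : ℕ} [Nonempty V] (hδ : δ ≤ 1) (G : SimpleGraph V)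
    (C : Finset V)
    (hC : ∀ u ∈ C, ∀ v ∈ C, u ≠ v → δ * Fintype.card V ≤ (nbrDiff G u v).card)
    (hm : (C.card : ℝ) ^ 2 * (1 - δ) ^ m < 1) :
    ∃ φ : Fin m → V, ∀ u ∈ C, ∀ v ∈ C, u ≠ v → ∃ i, φ i ∈ nbrDiff G u v := by
  classical
  by_contra! hcon
  have hsub : (Finset.univ : Finset (Fin m → V)) ⊆
      C.offDiag.biUnion fun p ↦ Fintype.piFinset fun _ ↦ (nbrDiff G p.1 p.2)ᶜ := by
    intro φ _
    obtain ⟨u, hu, v, hv, huv, h⟩ := hcon φ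
    simp only [Finset.mem_biUnion, Finset.mem_offDiag, Fintype.mem_piFinset, Finset.mem_compl]
    exact ⟨(u, v), ⟨hu, hv, huv⟩, h⟩
  have hn : (0 : ℝ) < Fintype.card V := by exact_mod_cast Fintype.card_pos
  have h1 := (Finset.card_le_card hsub).trans Finset.card_biUnion_le
  have h2 : (Fintype.card V : ℝ) ^ m ≤
      ∑ p ∈ C.offDiag, ((1 - δ) * Fintype.card V) ^ m := by
    have h3 : (Fintype.card V : ℝ) ^ m ≤
        ∑ p ∈ C.offDiag, (((nbrDiff G p.1 p.2)ᶜ.card : ℕ) : ℝ) ^ m := by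
      have := h1
      simp only [Finset.card_univ, Fintype.card_pi_const, Fintype.card_piFinset_const] at this
      exact_mod_cast this
    refine h3.trans (Finset.sum_le_sum fun p hp ↦ ?_)
    rw [Finset.mem_offDiag] at hp
    have := hC p.1 hp.1 p.2 hp.2.1 hp.2.2
    refine pow_le_pow_left₀ (by positivity) ?_ m
    rw [Finset.card_compl, Nat.cast_sub (Finset.card_le_univ _)]
    linarith
  rw [Finset.sum_const, nsmul_eq_mul, mul_pow] at h2
  have h4 : (C.offDiag.card : ℝ) ≤ (C.card : ℝ) ^ 2 := by
    rw [sq]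
    have : C.offDiag.card ≤ C.card * C.card := by rw [Finset.offDiag_card]; omega
    exact_mod_cast this
  have h5 : (0 : ℝ) ≤ (1 - δ) ^ m := pow_nonneg (by linarith) m
  have h6 : (0 : ℝ) < (Fintype.card V : ℝ) ^ m := by positivity
  nlinarith [mul_le_mul_of_nonneg_right h4 h5]

/-- Some sample size `m` makes the union bound succeed for one more vertex than Sauer–Shelah
allows. -/
theorem exists_sample_size (d : ℕ) {δ : ℝ} (hδ : 0 < δ) (hδ1 : δ < 1) :
    ∃ m : ℕ, (((d + 1) * (m + 1) ^ d + 1 : ℕ) : ℝ) ^ 2 * (1 - δ) ^ m < 1 := by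
  have hr : 0 < 1 - δ := by linarith
  have h := tendsto_pow_const_mul_const_pow_of_abs_lt_one (2 * d) (r := 1 - δ)
    (by rw [abs_of_pos hr]; linarith)
  have hc : (0 : ℝ) < (1 - δ) / (d + 2) ^ 2 := by positivity
  obtain ⟨M, hM⟩ := (h.eventually (gt_mem_nhds hc)).exists_forall_of_atTop
  refine ⟨M, ?_⟩
  have h1 := hM (M + 1) (Nat.le_succ M)
  rw [lt_div_iff₀ (by positivity), pow_succ (1 - δ)] at h1
  have h2 : ((M + 1 : ℕ) : ℝ) ^ (2 * d) * (1 - δ) ^ M * (d + 2) ^ 2 < 1 := by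
    refine lt_of_mul_lt_mul_right (a := 1 - δ) ?_ hr.le
    linarith
  refine lt_of_le_of_lt ?_ h2
  have h3 : (((d + 1) * (M + 1) ^ d + 1 : ℕ) : ℝ) ≤ (d + 2) * ((M + 1 : ℕ) : ℝ) ^ d := by
    have : (1 : ℝ) ≤ ((M + 1 : ℕ) : ℝ) ^ d := one_le_pow₀ (by
      push_cast
      linarith [M.cast_nonneg (α := ℝ)])
    push_cast at this ⊢
    linarith
  calc _ ≤ ((d + 2) * ((M + 1 : ℕ) : ℝ) ^ d) ^ 2 * (1 - δ) ^ M := by gcongr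
    _ = _ := by ring

/-- A weak form of Haussler's packing lemma: vertices whose neighbourhoods pairwise differ in a
`δ`-fraction of the vertices are boundedly many. -/
theorem exists_packing_bound (d : ℕ) {δ : ℝ} (hδ : 0 < δ) (hδ1 : δ < 1) :
    ∃ K : ℕ, ∀ (V : Type) [Fintype V] (G : SimpleGraph V), graphVCDim G ≤ d →
      ∀ C : Finset V, (∀ u ∈ C, ∀ v ∈ C, u ≠ v → δ * Fintype.card V ≤ (nbrDiff G u v).card) →
        C.card ≤ K := by
  obtain ⟨m, hm⟩ := exists_sample_size d hδ hδ1
  refine ⟨(d + 1) * (m + 1) ^ d, fun V _ G hG C hC ↦ ?_⟩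
  by_contra! hlt
  obtain ⟨C', hC', hcard⟩ := Finset.exists_subset_card_eq (Nat.succ_le_of_lt hlt)
  have hne : Nonempty V := by
    obtain ⟨x, -⟩ := Finset.card_pos.1 (hcard ▸ Nat.succ_pos _ : 0 < C'.card)
    exact ⟨x⟩
  obtain ⟨φ, hφ⟩ := exists_separating_sample (m := m) hδ1.le G C'
    (fun u hu v hv ↦ hC u (hC' hu) v (hC' hv)) (by rw [hcard]; exact hm)
  have := card_le_of_separated G hG C' φ hφ
  omega

/-- In a graph of bounded VC-dimension the vertices split into boundedly many classes (the fibres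
of `f`) such that any two vertices of a class have nearly the same neighbourhood. -/
theorem exists_nbrDiff_partition (d : ℕ) {δ : ℝ} (hδ : 0 < δ) (hδ1 : δ < 1) :
    ∃ K : ℕ, ∀ (V : Type) [Fintype V] [DecidableEq V] (G : SimpleGraph V), graphVCDim G ≤ d →
      ∃ f : V → V, (Finset.univ.image f).card ≤ K ∧
        ∀ u v, f u = f v → ((nbrDiff G u v).card : ℝ) ≤ δ * Fintype.card V := by
  obtain ⟨K, hK⟩ := exists_packing_bound d (δ := δ / 2) (by linarith) (by linarith)
  refine ⟨K, fun V _ _ G hG ↦ ?_⟩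
  classical
  -- The centres form a maximal packing; every vertex is then close to some centre.
  obtain ⟨C, hC, hmax⟩ := Finset.exists_max_image
    {C : Finset V | ∀ u ∈ C, ∀ v ∈ C, u ≠ v →
      δ / 2 * Fintype.card V ≤ (nbrDiff G u v).card} Finset.card ⟨∅, by simp⟩
  simp only [Finset.mem_filter, Finset.mem_univ, true_and] at hC hmax
  have hclose : ∀ v, ∃ c ∈ C, ((nbrDiff G v c).card : ℝ) ≤ δ / 2 * Fintype.card V := by
    intro v
    by_contra! hcon
    have hv : v ∉ C := fun hv ↦ by
      have := hcon v hv
      rw [nbrDiff_self, Finset.card_empty, Nat.cast_zero] at this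
      exact absurd this (not_lt.2 (by positivity))
    have := hmax (insert v C) ?_
    · rw [Finset.card_insert_of_notMem hv] at this
      omega
    · intro u hu w hw huw
      rw [Finset.mem_insert] at hu hw
      rcases hu with rfl | hu <;> rcases hw with rfl | hw
      · exact absurd rfl huw
      · exact (hcon w hw).le
      · rw [nbrDiff_comm]
        exact (hcon u hu).le
      · exact hC u hu w hw huw
  choose f hfC hf using hclose
  refine ⟨f, (Finset.card_le_card ?_).trans (hK V G hG C hC), fun u v huv ↦ ?_⟩
  · intro x hx
    obtain ⟨v, -, rfl⟩ := Finset.mem_image.1 hx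
    exact hfC v
  · have h1 : ((nbrDiff G u v).card : ℝ) ≤ (nbrDiff G u (f u)).card + (nbrDiff G (f u) v).card := by
      exact_mod_cast card_nbrDiff_triangle G u (f u) v
    have h2 := hf u
    have h3 := hf v
    rw [← huv, nbrDiff_comm] at h3
    linarith

end Packing

/-! ### Cliques from nearly complete families of sets -/

open Classical in
/-- The non-adjacent ordered pairs in `A × B`. Pairs `(a, a)` count as non-adjacent. -/
noncomputable def nonAdjPairs {V : Type*} (G : SimpleGraph V) (A B : Finset V) : Finset (V × V) :=
  (A ×ˢ B).filter fun p ↦ ¬G.Adj p.1 p.2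

theorem nonAdjPairs_mono {V : Type*} (G : SimpleGraph V) {A A' B B' : Finset V} (hA : A' ⊆ A)
    (hB : B' ⊆ B) : nonAdjPairs G A' B' ⊆ nonAdjPairs G A B := by
  classical
  exact Finset.filter_subset_filter _ (Finset.product_subset_product hA hB)

open Classical in
theorem card_nonAdjPairs {V : Type*} (G : SimpleGraph V) (A B : Finset V) :
    (nonAdjPairs G A B).card = ∑ a ∈ A, (B.filter fun b ↦ ¬G.Adj a b).card := by
  unfold nonAdjPairs
  simp only [Finset.card_filter]
  rw [Finset.sum_product]

open Classical in
/-- Markov's inequality: few vertices of `A` miss more than a quarter of `B`. -/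
theorem card_filter_many_nonAdj_le {V : Type*} (G : SimpleGraph V) {A B : Finset V} {η : ℝ}
    (hB : 0 < B.card) (h : ((nonAdjPairs G A B).card : ℝ) ≤ η * A.card * B.card) :
    ((A.filter fun u ↦ (1 / 4 : ℝ) * B.card < (B.filter fun w ↦ ¬G.Adj u w).card).card : ℝ) ≤
      4 * η * A.card := by
  set S := A.filter fun u ↦ (1 / 4 : ℝ) * B.card < (B.filter fun w ↦ ¬G.Adj u w).card with hS
  have hB' : (0 : ℝ) < B.card := by exact_mod_cast hB
  have h1 : (S.card : ℝ) * (1 / 4 * B.card) ≤ (nonAdjPairs G A B).card := by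
    rw [card_nonAdjPairs, Nat.cast_sum, ← nsmul_eq_mul]
    calc S.card • (1 / 4 * (B.card : ℝ))
        ≤ ∑ a ∈ S, ((B.filter fun b ↦ ¬G.Adj a b).card : ℝ) :=
          Finset.card_nsmul_le_sum _ _ _ fun a ha ↦ (Finset.mem_filter.1 ha).2.le
      _ ≤ _ := Finset.sum_le_sum_of_subset_of_nonneg (Finset.filter_subset _ _)
          fun _ _ _ ↦ Nat.cast_nonneg _
  refine le_of_mul_le_mul_right (a := 1 / 4 * (B.card : ℝ)) ?_ (by positivity)
  linarith

/-- Two vertices that each miss at most a quarter of `B` have half of `B` as common neighbours. -/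
theorem half_card_le_common_nbrs {V : Type*} (G : SimpleGraph V) {B B' : Finset V} {u v : V}
    (hB' : ∀ x, x ∈ B' ↔ x ∈ B ∧ G.Adj u x ∧ G.Adj v x)
    (hu : ∀ S ⊆ B, (∀ x ∈ S, ¬G.Adj u x) → (S.card : ℝ) ≤ 1 / 4 * B.card)
    (hv : ∀ S ⊆ B, (∀ x ∈ S, ¬G.Adj v x) → (S.card : ℝ) ≤ 1 / 4 * B.card) :
    (B.card : ℝ) / 2 ≤ B'.card := by
  classical
  have h1 := hu (B.filter fun x ↦ ¬G.Adj u x) (Finset.filter_subset _ _) (by simp)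
  have h2 := hv (B.filter fun x ↦ ¬G.Adj v x) (Finset.filter_subset _ _) (by simp)
  have h3 : B ⊆ B' ∪ ((B.filter fun x ↦ ¬G.Adj u x) ∪ (B.filter fun x ↦ ¬G.Adj v x)) := by
    intro x hx
    simp only [Finset.mem_union, hB', Finset.mem_filter]
    tauto
  have h4 := (Finset.card_le_card h3).trans ((Finset.card_union_le _ _).trans
    (Nat.add_le_add_left (Finset.card_union_le _ _) _))
  have h5 : (B.card : ℝ) ≤ B'.card + ((B.filter fun x ↦ ¬G.Adj u x).card +
    (B.filter fun x ↦ ¬G.Adj v x).card) := by exact_mod_cast h4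
  linarith

/-- If `k` large sets are pairwise almost completely joined and all sets of comparable size span an
edge, then one can choose an edge in each set so that the `2k` endpoints form a clique. -/
theorem exists_isNClique_of_nearly_complete (k : ℕ) :
    ∃ η : ℝ, 0 < η ∧ ∃ τ : ℝ, 0 < τ ∧ ∀ (V : Type) [Fintype V] (G : SimpleGraph V) (L : ℝ),
      0 < L → ∀ A : Fin k → Finset V, (∀ i, L ≤ (A i).card) →
      (∀ i j, i ≠ j → ((nonAdjPairs G (A i) (A j)).card : ℝ) ≤ η * (A i).card * (A j).card) →
      (∀ S : Finset V, τ * L ≤ S.card → ∃ u ∈ S, ∃ v ∈ S, G.Adj u v) →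
      ∃ T : Finset V, G.IsNClique (2 * k) T ∧ ∀ x ∈ T, ∃ i, x ∈ A i := by
  induction k with
  | zero =>
    refine ⟨1, one_pos, 1, one_pos, fun V _ G L _ A _ _ _ ↦ ⟨∅, ?_, by simp⟩⟩
    simp [SimpleGraph.isNClique_iff]
  | succ k ih =>
    obtain ⟨η, hη, τ, hτ, ih⟩ := ih
    refine ⟨min (η / 4) (1 / (8 * (k + 1))), by positivity, min (τ / 2) (1 / 2), by positivity,
      fun V _ G L hL A hA hdense hedge ↦ ?_⟩
    classical
    -- The bound `η' ≤ 1 / (8 (k + 1))` leaves half of `A 0` after removing the vertices that miss a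
    -- quarter of another set; `η' ≤ η / 4` pays for halving both sets of each remaining pair.
    set η' := min (η / 4) (1 / (8 * ((k : ℝ) + 1))) with hη'
    have hpos : ∀ i, 0 < (A i).card := fun i ↦ by
      have := hL.trans_le (hA i)
      exact_mod_cast this
    let bad : Fin k → Finset V := fun j ↦ (A 0).filter fun u ↦
      (1 / 4 : ℝ) * (A j.succ).card < ((A j.succ).filter fun w ↦ ¬G.Adj u w).card
    have hbad : ∀ j, ((bad j).card : ℝ) ≤ 4 * η' * (A 0).card := fun j ↦
      card_filter_many_nonAdj_le G (hpos _) (hdense 0 j.succ (Fin.succ_ne_zero j).symm)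
    let S := A 0 \ Finset.univ.biUnion bad
    have hS : ((A 0).card : ℝ) / 2 ≤ S.card := by
      have h1 : (A 0).card ≤ S.card + ∑ j, (bad j).card := by
        have h2 : (Finset.univ.biUnion bad).card ≤ ∑ j, (bad j).card := Finset.card_biUnion_le
        have h3 := Finset.card_le_card_sdiff_add_card (s := A 0) (t := Finset.univ.biUnion bad)
        change (A 0).card ≤ S.card + _ at h3
        omega
      have h2 : ((A 0).card : ℝ) ≤ S.card + ∑ j, ((bad j).card : ℝ) := by exact_mod_cast h1
      have h3 : ∑ j, ((bad j).card : ℝ) ≤ k * (4 * η' * (A 0).card) := by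
        refine (Finset.sum_le_card_nsmul _ _ _ fun j _ ↦ hbad j).trans ?_
        simp
      have h4 : (k : ℝ) * (4 * η') ≤ 1 / 2 := by
        have h5 : η' ≤ 1 / (8 * ((k : ℝ) + 1)) := min_le_right _ _
        rw [le_div_iff₀ (by positivity)] at h5
        have h6 : 0 < η' := by positivity
        linarith
      have h7 := mul_le_mul_of_nonneg_right h4 (Nat.cast_nonneg (α := ℝ) (A 0).card)
      linarith
    obtain ⟨u, hu, v, hv, huv⟩ := hedge S (by
      have h1 : min (τ / 2) (1 / 2) * L ≤ 1 / 2 * L :=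
        mul_le_mul_of_nonneg_right (min_le_right _ _) hL.le
      have h2 := hA 0
      linarith)
    have hgood : ∀ x ∈ S, ∀ j : Fin k, ∀ R ⊆ A j.succ, (∀ y ∈ R, ¬G.Adj x y) →
        (R.card : ℝ) ≤ 1 / 4 * (A j.succ).card := by
      intro x hx j R hR hRx
      rw [Finset.mem_sdiff, Finset.mem_biUnion, not_exists] at hx
      have h1 := hx.2 j
      simp only [bad, Finset.mem_univ, true_and, Finset.mem_filter, hx.1, not_lt] at h1
      refine le_trans ?_ h1
      exact_mod_cast Finset.card_le_card fun y hy ↦ Finset.mem_filter.2 ⟨hR hy, hRx y hy⟩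
    let A' : Fin k → Finset V := fun j ↦ (A j.succ).filter fun x ↦ G.Adj u x ∧ G.Adj v x
    have hA'sub : ∀ j, A' j ⊆ A j.succ := fun j ↦ Finset.filter_subset _ _
    have hA' : ∀ j, ((A j.succ).card : ℝ) / 2 ≤ (A' j).card := fun j ↦
      half_card_le_common_nbrs G (fun x ↦ by simp [A']) (hgood u hu j) (hgood v hv j)
    obtain ⟨T, hT, hTA⟩ := ih V G (L / 2) (by linarith) A'
      (fun j ↦ by linarith [hA' j, hA j.succ])
      (fun i j hij ↦ by
        have h1 := hdense i.succ j.succ (fun h ↦ hij (Fin.succ_injective _ h))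
        have h2 : ((nonAdjPairs G (A' i) (A' j)).card : ℝ) ≤
            (nonAdjPairs G (A i.succ) (A j.succ)).card := by
          exact_mod_cast Finset.card_le_card (nonAdjPairs_mono G (hA'sub i) (hA'sub j))
        have h3 : η' ≤ η / 4 := min_le_left _ _
        calc ((nonAdjPairs G (A' i) (A' j)).card : ℝ)
            ≤ η' * (A i.succ).card * (A j.succ).card := h2.trans h1
          _ ≤ η / 4 * (A i.succ).card * (A j.succ).card := by gcongr
          _ = η * ((A i.succ).card / 2) * ((A j.succ).card / 2) := by ring
          _ ≤ η * (A' i).card * (A' j).card := by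
            gcongr
            · exact hA' i
            · exact hA' j)
      (fun R hR ↦ hedge R (by
        have h1 : min (τ / 2) (1 / 2) * L ≤ τ / 2 * L :=
          mul_le_mul_of_nonneg_right (min_le_left _ _) hL.le
        linarith))
    have hTuv : ∀ x ∈ T, G.Adj u x ∧ G.Adj v x := fun x hx ↦ by
      obtain ⟨i, hi⟩ := hTA x hx
      exact (Finset.mem_filter.1 hi).2
    refine ⟨insert u (insert v T), ?_, ?_⟩
    · have h1 : G.IsNClique (2 * k + 1) (insert v T) := hT.insert fun x hx ↦ (hTuv x hx).2
      refine h1.insert fun x hx ↦ ?_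
      rcases Finset.mem_insert.1 hx with rfl | hx
      · exact huv
      · exact (hTuv x hx).1
    · intro x hx
      rw [Finset.mem_insert, Finset.mem_insert] at hx
      rcases hx with rfl | rfl | hx
      · exact ⟨0, (Finset.mem_sdiff.1 hu).1⟩
      · exact ⟨0, (Finset.mem_sdiff.1 hv).1⟩
      · obtain ⟨i, hi⟩ := hTA x hx
        exact ⟨i.succ, hA'sub i hi⟩

/-! ### Edges between classes of nearly equal neighbourhoods -/

section Partition

variable {V : Type*} [Fintype V] [DecidableEq V]

/-- The class of `v` in the partition of the vertices into the fibres of `f`. -/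
def fibre (f : V → V) (v : V) : Finset V := {x | f x = f v}

theorem mem_fibre {f : V → V} {v x : V} : x ∈ fibre f v ↔ f x = f v := by simp [fibre]

theorem fibre_eq_of_eq {f : V → V} {v w : V} (h : f v = f w) : fibre f v = fibre f w := by
  simp [fibre, h]

theorem card_fibre_pos (f : V → V) (v : V) : (0 : ℝ) < (fibre f v).card := by
  exact_mod_cast Finset.card_pos.2 ⟨v, mem_fibre.2 rfl⟩

/-- The transition kernel that resamples a vertex uniformly within its class. -/
noncomputable def resample (f : V → V) (v x : V) : ℝ :=
  if f x = f v then ((fibre f v).card : ℝ)⁻¹ else 0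

theorem resample_nonneg (f : V → V) (v x : V) : 0 ≤ resample f v x := by
  unfold resample
  split_ifs <;> positivity

theorem resample_comm (f : V → V) (v x : V) : resample f v x = resample f x v := by
  unfold resample
  by_cases h : f x = f v
  · rw [if_pos h, if_pos h.symm, fibre_eq_of_eq h]
  · rw [if_neg h, if_neg (Ne.symm h)]

theorem sum_resample_mul (f : V → V) (v : V) (F : V → ℝ) :
    ∑ x, resample f v x * F x = ((fibre f v).card : ℝ)⁻¹ * ∑ x ∈ fibre f v, F x := by
  simp only [resample, ite_mul, zero_mul]
  rw [← Finset.sum_filter, Finset.mul_sum]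
  rfl

theorem sum_resample (f : V → V) (v : V) : ∑ x, resample f v x = 1 := by
  have := sum_resample_mul f v fun _ ↦ 1
  simp only [mul_one, Finset.sum_const, nsmul_eq_mul] at this
  rw [this, inv_mul_cancel₀ (card_fibre_pos f v).ne']

theorem sum_resample_mul_nbrDiff_le (G : SimpleGraph V) (f : V → V) {D : ℝ}
    (hf : ∀ u v, f u = f v → ((nbrDiff G u v).card : ℝ) ≤ D) :
    ∑ v, ∑ x, resample f v x * (nbrDiff G v x).card ≤ Fintype.card V * D := by
  have h : ∀ v, ∑ x, resample f v x * (nbrDiff G v x).card ≤ D := fun v ↦ by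
    calc _ ≤ ∑ x, resample f v x * D := by
          refine Finset.sum_le_sum fun x _ ↦ ?_
          unfold resample
          split_ifs with hx
          · exact mul_le_mul_of_nonneg_left (hf v x hx.symm) (by positivity)
          · simp
      _ = D := by rw [← Finset.sum_mul, sum_resample, one_mul]
  refine (Finset.sum_le_card_nsmul _ _ _ fun v _ ↦ h v).trans ?_
  simp

open Classical in
/-- The edges (as ordered pairs) whose two classes have non-adjacency density above `η`. -/
noncomputable def sparseEdges (G : SimpleGraph V) (f : V → V) (η : ℝ) : Finset (V × V) :=
  {p | G.Adj p.1 p.2 ∧ η * (fibre f p.1).card * (fibre f p.2).card <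
    (nonAdjPairs G (fibre f p.1) (fibre f p.2)).card}

open Classical in
/-- If both endpoints of an edge `vw` in a pair of classes with many non-adjacent pairs are
resampled within their classes, an edge becomes a non-edge with probability above `η`; this happens
only if one of the two replacements crosses a difference of neighbourhoods. -/
theorem sparse_indicator_le (G : SimpleGraph V) (f : V → V) (η : ℝ) (v w : V) :
    (if (v, w) ∈ sparseEdges G f η then η else 0) ≤
      ∑ x, ∑ y, resample f v x * resample f w y *
        ((if w ∈ nbrDiff G v x then 1 else 0) + if x ∈ nbrDiff G w y then 1 else 0) := by
  split_ifs with h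
  · rw [sparseEdges, Finset.mem_filter] at h
    obtain ⟨-, hadj, hη⟩ := h
    dsimp only at hadj hη
    have hv := card_fibre_pos f v
    have hw := card_fibre_pos f w
    have h1 : η ≤ ((fibre f v).card : ℝ)⁻¹ * (((fibre f w).card : ℝ)⁻¹ *
        (nonAdjPairs G (fibre f v) (fibre f w)).card) := by
      rw [inv_mul_eq_div, inv_mul_eq_div, le_div_iff₀ hv, le_div_iff₀ hw]
      exact hη.le
    have h2 : ((fibre f v).card : ℝ)⁻¹ * (((fibre f w).card : ℝ)⁻¹ *
        (nonAdjPairs G (fibre f v) (fibre f w)).card) =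
        ∑ x, ∑ y, resample f v x * resample f w y * (if G.Adj x y then 0 else 1) := by
      simp only [mul_assoc, ← Finset.mul_sum]
      rw [sum_resample_mul]
      simp only [sum_resample_mul]
      rw [← Finset.mul_sum, card_nonAdjPairs]
      simp only [Finset.card_filter]
      push_cast
      simp only [ite_not]
    rw [h2] at h1
    refine h1.trans (Finset.sum_le_sum fun x _ ↦ Finset.sum_le_sum fun y _ ↦ ?_)
    refine mul_le_mul_of_nonneg_left ?_
      (mul_nonneg (resample_nonneg f v x) (resample_nonneg f w y))
    simp only [mem_nbrDiff]
    by_cases hxy : G.Adj x y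
    · simp only [hxy, if_true]
      positivity
    · by_cases hxw : G.Adj x w
      · have : ¬(G.Adj w x ↔ G.Adj y x) := fun h ↦ hxy ((h.1 hxw.symm).symm)
        rw [if_neg hxy, if_pos this]
        have : (0 : ℝ) ≤ if ¬(G.Adj v w ↔ G.Adj x w) then 1 else 0 := by positivity
        linarith
      · have : ¬(G.Adj v w ↔ G.Adj x w) := fun h ↦ hxw (h.1 hadj)
        rw [if_neg hxy, if_pos this]
        have : (0 : ℝ) ≤ if ¬(G.Adj w x ↔ G.Adj y x) then 1 else 0 := by positivity
        linarith
  · refine Finset.sum_nonneg fun x _ ↦ Finset.sum_nonneg fun y _ ↦ ?_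
    have := mul_nonneg (resample_nonneg f v x) (resample_nonneg f w y)
    positivity

/-- Averaging the resampling estimate over all ordered pairs; here `D` bounds the differences of
neighbourhoods within a class. -/
theorem card_sparseEdges_le (G : SimpleGraph V) (f : V → V) (η : ℝ) {D : ℝ}
    (hf : ∀ u v, f u = f v → ((nbrDiff G u v).card : ℝ) ≤ D) :
    η * (sparseEdges G f η).card ≤ 2 * (Fintype.card V * D) := by
  classical
  have h0 : η * (sparseEdges G f η).card =
      ∑ v, ∑ w, if (v, w) ∈ sparseEdges G f η then η else 0 := by
    rw [← Fintype.sum_prod_type', ← Finset.sum_filter, Finset.filter_mem_eq_inter,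
      Finset.univ_inter, Finset.sum_const, nsmul_eq_mul, mul_comm]
  have hcard : ∀ v x, ∑ w, (if w ∈ nbrDiff G v x then (1 : ℝ) else 0) = (nbrDiff G v x).card := by
    intro v x
    simp
  have h1 : ∑ v, ∑ w, ∑ x, ∑ y, resample f v x * resample f w y *
      (if w ∈ nbrDiff G v x then (1 : ℝ) else 0) =
      ∑ v, ∑ x, resample f v x * (nbrDiff G v x).card := by
    refine Finset.sum_congr rfl fun v _ ↦ ?_
    rw [Finset.sum_comm]
    refine Finset.sum_congr rfl fun x _ ↦ ?_
    rw [← hcard, Finset.mul_sum]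
    refine Finset.sum_congr rfl fun w _ ↦ ?_
    rw [← Finset.sum_mul, ← Finset.mul_sum, sum_resample, mul_one]
  have h2 : ∑ v, ∑ w, ∑ x, ∑ y, resample f v x * resample f w y *
      (if x ∈ nbrDiff G w y then (1 : ℝ) else 0) =
      ∑ w, ∑ y, resample f w y * (nbrDiff G w y).card := by
    rw [Finset.sum_comm]
    refine Finset.sum_congr rfl fun w _ ↦ ?_
    rw [Finset.sum_comm]
    simp only [← hcard, Finset.mul_sum]
    conv_rhs => rw [Finset.sum_comm]
    refine Finset.sum_congr rfl fun x _ ↦ ?_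
    rw [Finset.sum_comm]
    refine Finset.sum_congr rfl fun y _ ↦ ?_
    simp only [resample_comm f _ x, mul_assoc]
    rw [← Finset.sum_mul, sum_resample, one_mul]
  rw [h0]
  calc _ ≤ ∑ v, ∑ w, ∑ x, ∑ y, resample f v x * resample f w y *
        ((if w ∈ nbrDiff G v x then 1 else 0) + if x ∈ nbrDiff G w y then 1 else 0) :=
        Finset.sum_le_sum fun v _ ↦ Finset.sum_le_sum fun w _ ↦ sparse_indicator_le G f η v w
    _ = ∑ v, ∑ x, resample f v x * (nbrDiff G v x).card +
        ∑ w, ∑ y, resample f w y * (nbrDiff G w y).card := by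
        refine Eq.trans ?_ (congrArg₂ (· + ·) h1 h2)
        simp only [mul_add, Finset.sum_add_distrib]
    _ ≤ _ := by linarith [sum_resample_mul_nbrDiff_le G f hf]

theorem card_small_fibres_le (f : V → V) {K : ℕ} (hK : (Finset.univ.image f).card ≤ K) {c : ℝ}
    (hc : 0 ≤ c) (S : Finset V) (hS : ∀ v ∈ S, ((fibre f v).card : ℝ) < c) :
    (S.card : ℝ) ≤ K * c := by
  have h : S.card ≤ ⌊c⌋₊ * (S.image f).card := by
    refine Finset.card_le_mul_card_image S _ fun a ha ↦ ?_
    obtain ⟨v, hv, rfl⟩ := Finset.mem_image.1 ha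
    refine (Finset.card_le_card fun x hx ↦ ?_).trans (Nat.le_floor (hS v hv).le)
    exact mem_fibre.2 (Finset.mem_filter.1 hx).2
  have h2 : (S.image f).card ≤ K :=
    (Finset.card_le_card (Finset.image_subset_image (Finset.subset_univ S))).trans hK
  calc (S.card : ℝ) ≤ ⌊c⌋₊ * (S.image f).card := by exact_mod_cast h
    _ ≤ c * K := by
      gcongr
      exact Nat.floor_le hc
    _ = K * c := mul_comm _ _

end Partition

/-! ### Turán's theorem after cleaning -/

open Classical in
theorem two_mul_ncard_edgeSet {V : Type*} [Fintype V] (G : SimpleGraph V) :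
    2 * G.edgeSet.ncard = (Finset.univ.filter fun p : V × V ↦ G.Adj p.1 p.2).card := by
  rw [← SimpleGraph.coe_edgeFinset, Set.ncard_coe_finset, ← G.sum_degrees_eq_twice_card_edges,
    Finset.card_filter, Fintype.sum_prod_type]
  refine Finset.sum_congr rfl fun v _ ↦ ?_
  rw [← Finset.card_filter, ← SimpleGraph.card_neighborFinset_eq_degree]
  congr 1
  ext w
  simp

open Classical in
/-- Turán's theorem, counting ordered edges. -/
theorem exists_clique_of_many_edges {V : Type*} [Fintype V] (G : SimpleGraph V) {r : ℕ}
    (hr : 0 < r) (h : (1 - 1 / (r : ℝ)) * (Fintype.card V : ℝ) ^ 2 <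
      (Finset.univ.filter fun p : V × V ↦ G.Adj p.1 p.2).card) :
    ¬G.CliqueFree (r + 1) := by
  intro hG
  have h1 : G.edgeFinset.card ≤ (SimpleGraph.turanGraph (Fintype.card V) r).edgeFinset.card := by
    rw [SimpleGraph.card_edgeFinset_turanGraph]
    exact hG.card_edgeFinset_le
  have h2 : 2 * r * G.edgeFinset.card ≤ (r - 1) * Fintype.card V ^ 2 :=
    (Nat.mul_le_mul_left _ h1).trans SimpleGraph.mul_card_edgeFinset_turanGraph_le
  have h3 := two_mul_ncard_edgeSet G
  rw [← SimpleGraph.coe_edgeFinset, Set.ncard_coe_finset] at h3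
  rw [← h3] at h
  have h4 : (2 : ℝ) * r * G.edgeFinset.card ≤ (r - 1) * (Fintype.card V : ℝ) ^ 2 := by
    have : ((2 * r * G.edgeFinset.card : ℕ) : ℝ) ≤ ((r - 1) * Fintype.card V ^ 2 : ℕ) := by
      exact_mod_cast h2
    rw [Nat.cast_mul, Nat.cast_mul, Nat.cast_mul, Nat.cast_sub hr] at this
    push_cast at this
    exact this
  have hr' : (0 : ℝ) < r := by exact_mod_cast hr
  have h5 : r * ((1 - 1 / (r : ℝ)) * (Fintype.card V : ℝ) ^ 2) =
      (r - 1) * (Fintype.card V : ℝ) ^ 2 := by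
    field_simp
  push_cast at h
  have h6 := mul_lt_mul_of_pos_left h hr'
  linarith

/-- The graph left after deleting the edges at vertices in classes smaller than `c` and the edges
between two classes with non-adjacency density above `η`. -/
def cleaned {V : Type*} [Fintype V] [DecidableEq V] (G : SimpleGraph V) (f : V → V) (η c : ℝ) :
    SimpleGraph V where
  Adj v w := G.Adj v w ∧ (c ≤ (fibre f v).card ∧ c ≤ (fibre f w).card) ∧
    ((nonAdjPairs G (fibre f v) (fibre f w)).card ≤ η * (fibre f v).card * (fibre f w).card ∧
    (nonAdjPairs G (fibre f w) (fibre f v)).card ≤ η * (fibre f w).card * (fibre f v).card)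
  symm := ⟨fun _ _ h ↦ ⟨h.1.symm, h.2.1.symm, h.2.2.symm⟩⟩
  loopless := ⟨fun v h ↦ G.loopless.irrefl v h.1⟩

open Classical in
theorem card_adj_le_cleaned {V : Type*} [Fintype V] (G : SimpleGraph V)
    (f : V → V) {η D c : ℝ} {K : ℕ} (hη : 0 < η) (hc : 0 ≤ c)
    (hK : (Finset.univ.image f).card ≤ K)
    (hf : ∀ u v, f u = f v → ((nbrDiff G u v).card : ℝ) ≤ D) :
    ((Finset.univ.filter fun p : V × V ↦ G.Adj p.1 p.2).card : ℝ) ≤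
      (Finset.univ.filter fun p : V × V ↦ (cleaned G f η c).Adj p.1 p.2).card +
      4 * (Fintype.card V * D) / η + 2 * (K * c * Fintype.card V) := by
  set S : Finset V := {v | ((fibre f v).card : ℝ) < c} with hS
  have hScard := card_small_fibres_le f hK hc S fun v hv ↦ (Finset.mem_filter.1 hv).2
  have hsp : ((sparseEdges G f η).card : ℝ) ≤ 2 * (Fintype.card V * D) / η := by
    rw [le_div_iff₀ hη, mul_comm]
    exact card_sparseEdges_le G f η hf
  have hsub : (Finset.univ.filter fun p : V × V ↦ G.Adj p.1 p.2) ⊆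
      (Finset.univ.filter fun p : V × V ↦ (cleaned G f η c).Adj p.1 p.2) ∪
      (sparseEdges G f η ∪ (sparseEdges G f η).image Prod.swap ∪
        (S ×ˢ Finset.univ ∪ Finset.univ ×ˢ S)) := by
    rintro ⟨v, w⟩ h
    simp only [Finset.mem_filter, Finset.mem_univ, true_and] at h
    by_contra hcon
    simp only [Finset.mem_union, Finset.mem_filter, Finset.mem_univ, true_and, not_or,
      Finset.mem_product, and_true, hS, not_lt] at hcon
    obtain ⟨h1, ⟨h2, h3⟩, h4, h5⟩ := hcon
    refine h1 ⟨h, ⟨h4, h5⟩, ?_, ?_⟩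
    · by_contra! h6
      exact h2 (Finset.mem_filter.2 ⟨Finset.mem_univ _, h, h6⟩)
    · by_contra! h6
      exact h3 (Finset.mem_image.2 ⟨(w, v),
        Finset.mem_filter.2 ⟨Finset.mem_univ _, h.symm, h6⟩, rfl⟩)
  have hle := (Finset.card_le_card hsub).trans (Finset.card_union_le _ _)
  have hle2 := Finset.card_union_le (sparseEdges G f η ∪ (sparseEdges G f η).image Prod.swap)
    (S ×ˢ Finset.univ ∪ Finset.univ ×ˢ S)
  have hle3 := Finset.card_union_le (sparseEdges G f η) ((sparseEdges G f η).image Prod.swap)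
  have hle4 := Finset.card_union_le (S ×ˢ (Finset.univ : Finset V)) (Finset.univ ×ˢ S)
  have hle5 : ((sparseEdges G f η).image Prod.swap).card ≤ (sparseEdges G f η).card :=
    Finset.card_image_le
  rw [Finset.card_product, Finset.card_product, Finset.card_univ] at hle4
  have hfin : (Finset.univ.filter fun p : V × V ↦ G.Adj p.1 p.2).card ≤
      (Finset.univ.filter fun p : V × V ↦ (cleaned G f η c).Adj p.1 p.2).card +
      2 * (sparseEdges G f η).card + 2 * (S.card * Fintype.card V) := by
    linarith [mul_comm S.card (Fintype.card V)]
  have hfin' : ((Finset.univ.filter fun p : V × V ↦ G.Adj p.1 p.2).card : ℝ) ≤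
      (Finset.univ.filter fun p : V × V ↦ (cleaned G f η c).Adj p.1 p.2).card +
      2 * (sparseEdges G f η).card + 2 * (S.card * Fintype.card V) := by
    exact_mod_cast hfin
  have h6 := mul_le_mul_of_nonneg_right hScard (Nat.cast_nonneg (α := ℝ) (Fintype.card V))
  have h7 : 4 * (Fintype.card V * D) / η = 2 * (2 * (Fintype.card V * D) / η) := by ring
  linarith

/-- A graph of bounded VC-dimension whose edge density exceeds that of the Turán graph with `r`
parts contains a `K_{2r+2}` or a linear-sized independent set. -/
theorem exists_linear_isIndepSet (d : ℕ) {r : ℕ} (hr : 0 < r) {ε : ℝ} (hε : 0 < ε) :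
    ∃ γ : ℝ, 0 < γ ∧ ∀ (V : Type) [Fintype V] (G : SimpleGraph V), graphVCDim G ≤ d →
      G.CliqueFree (2 * (r + 1)) →
      (1 - 1 / (r : ℝ) + ε) * (Fintype.card V : ℝ) ^ 2 < 2 * (G.edgeSet.ncard : ℝ) →
      ∃ I : Finset V, G.IsIndepSet I ∧ γ * Fintype.card V ≤ I.card := by
  obtain ⟨η, hη, τ, hτ, hclique⟩ := exists_isNClique_of_nearly_complete (r + 1)
  -- Sparse pairs of classes then cost at most `4 δ / η ≤ ε / 4` of the edge density.
  set δ : ℝ := min (η * ε / 16) (1 / 2) with hδ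
  have hδ0 : 0 < δ := by positivity
  obtain ⟨K, hK⟩ := exists_nbrDiff_partition d hδ0 ((min_le_right _ _).trans_lt (by norm_num))
  -- Small classes cost at most `2 K c ≤ ε / 4` of the edge density.
  set c : ℝ := ε / (8 * (K + 1)) with hc
  have hc0 : 0 < c := by positivity
  refine ⟨τ * c, by positivity, fun V _ G hvc hfree hedges ↦ ?_⟩
  classical
  by_contra! hcon
  set n : ℝ := (Fintype.card V : ℝ) with hn
  have hn0 : 0 < n := by
    rcases Nat.eq_zero_or_pos (Fintype.card V) with h | h
    · have h1 : n = 0 := by rw [hn, h, Nat.cast_zero]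
      have h2 := two_mul_ncard_edgeSet G
      have : IsEmpty V := Fintype.card_eq_zero_iff.1 h
      rw [Finset.univ_eq_empty, Finset.filter_empty, Finset.card_empty] at h2
      have h3 : 2 * (G.edgeSet.ncard : ℝ) = 0 := by exact_mod_cast h2
      rw [h1, h3] at hedges
      simp at hedges
    · rw [hn]
      exact_mod_cast h
  obtain ⟨f, hfK, hf⟩ := hK V G hvc
  have hclean := card_adj_le_cleaned G f (c := c * n) hη (by positivity) hfK hf
  have hmany : (1 - 1 / (r : ℝ)) * n ^ 2 <
      (Finset.univ.filter fun p : V × V ↦ (cleaned G f η (c * n)).Adj p.1 p.2).card := by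
    have h1 : 4 * (n * (δ * n)) / η ≤ ε / 4 * n ^ 2 := by
      rw [div_le_iff₀ hη]
      have : δ ≤ η * ε / 16 := min_le_left _ _
      nlinarith [mul_le_mul_of_nonneg_right this (sq_nonneg n)]
    have h2 : 2 * (K * (c * n) * n) ≤ ε / 4 * n ^ 2 := by
      have h3 : K * c ≤ ε / 8 := by
        rw [hc, ← mul_div_assoc, div_le_iff₀ (by positivity)]
        nlinarith
      nlinarith [mul_le_mul_of_nonneg_right h3 (sq_nonneg n)]
    have h3 : 2 * (G.edgeSet.ncard : ℝ) =
        (Finset.univ.filter fun p : V × V ↦ G.Adj p.1 p.2).card := by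
      exact_mod_cast two_mul_ncard_edgeSet G
    have h4 : 0 < ε * n ^ 2 := by positivity
    linarith
  obtain ⟨φ⟩ := (SimpleGraph.not_cliqueFree_iff_top_isContained _).1
    (exists_clique_of_many_edges _ hr hmany)
  have hφ : ∀ i j, i ≠ j → (cleaned G f η (c * n)).Adj (φ i) (φ j) := fun i j hij ↦
    φ.toHom.map_adj hij
  have hbig : ∀ i, c * n ≤ (fibre f (φ i)).card := fun i ↦ by
    have : Nontrivial (Fin (r + 1)) := Fin.nontrivial_iff_two_le.2 (by omega)
    obtain ⟨j, hj⟩ := exists_ne i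
    exact (hφ i j hj.symm).2.1.1
  obtain ⟨T, hT, -⟩ := hclique V G (c * n) (by positivity) (fun i ↦ fibre f (φ i)) hbig
    (fun i j hij ↦ (hφ i j hij).2.2.1) (fun S hS ↦ by
      by_contra! hind
      have := hcon S fun u hu v hv _ ↦ hind u hu v hv
      linarith)
  exact hT.not_cliqueFree hfree

/-! ### A polarity graph of girth five with small independence number -/

/-- The polarity relation on the plane `F × F`: `(a, x)` and `(b, y)` are related when
`x + y = (a - b) ^ 2`. Under the substitution `x ↦ a ^ 2 - x` of the second coordinates it becomes
`x + y = 2 * a * b`, the incidence of the point `(a, x)` with the line `x = 2 * b * a - y`,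
so in odd characteristic any two points have at most one common neighbour. -/
def PlaneRel {F : Type*} [Field F] (s t : F × F) : Prop := s.2 + t.2 = (s.1 - t.1) ^ 2

section Plane

variable {F : Type*} [Field F]

theorem planeRel_comm {s t : F × F} : PlaneRel s t ↔ PlaneRel t s := by
  unfold PlaneRel
  rw [add_comm, ← neg_sub, neg_sq]

theorem planeRel_iff {s t : F × F} : PlaneRel s t ↔ t = (t.1, (s.1 - t.1) ^ 2 - s.2) := by
  unfold PlaneRel
  rw [Prod.ext_iff, eq_sub_iff_add_eq']
  simp

theorem eq_of_planeRel (h2 : (2 : F) ≠ 0) {s t u v : F × F} (hst : s ≠ t)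
    (hsu : PlaneRel s u) (htu : PlaneRel t u) (hsv : PlaneRel s v) (htv : PlaneRel t v) :
    u = v := by
  unfold PlaneRel at *
  have h1 : s.1 ≠ t.1 := by
    intro h
    refine hst (Prod.ext h ?_)
    rw [h] at hsu
    linear_combination hsu - htu
  have h3 : u.1 = v.1 := by
    have h4 : (2 * (s.1 - t.1)) * (u.1 - v.1) = 0 := by
      linear_combination hsu - htu - hsv + htv
    rcases mul_eq_zero.1 h4 with h | h
    · exact absurd h (mul_ne_zero h2 (sub_ne_zero.2 h1))
    · exact sub_eq_zero.1 h
  refine Prod.ext h3 ?_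
  rw [h3] at hsu
  linear_combination hsu - hsv

/-- In a triangle of the polarity relation the product of the negated second coordinates is a
square, namely the square of the Vandermonde product of the first coordinates. -/
theorem prod_eq_sq_of_triangle (h2 : (2 : F) ≠ 0) {s t u : F × F}
    (hst : PlaneRel s t) (hsu : PlaneRel s u) (htu : PlaneRel t u) :
    (-s.2) * (-t.2) * (-u.2) = ((s.1 - t.1) * (s.1 - u.1) * (t.1 - u.1)) ^ 2 := by
  unfold PlaneRel at *
  have hs : s.2 = (s.1 - t.1) * (s.1 - u.1) := mul_left_cancel₀ h2 (by
    linear_combination hst + hsu - htu)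
  have ht : t.2 = (t.1 - s.1) * (t.1 - u.1) := mul_left_cancel₀ h2 (by
    linear_combination hst + htu - hsu)
  have hu : u.2 = (u.1 - s.1) * (u.1 - t.1) := mul_left_cancel₀ h2 (by
    linear_combination hsu + htu - hst)
  rw [hs, ht, hu]
  ring

variable [Fintype F] [DecidableEq F]

open Classical in
theorem card_planeRel (s : F × F) :
    (Finset.univ.filter fun v ↦ PlaneRel s v).card = Fintype.card F := by
  have h : (Finset.univ.filter fun v ↦ PlaneRel s v) =
      Finset.univ.image fun c : F ↦ (c, (s.1 - c) ^ 2 - s.2) := by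
    ext v
    simp only [Finset.mem_filter, Finset.mem_univ, true_and, Finset.mem_image]
    rw [planeRel_iff]
    exact ⟨fun h ↦ ⟨v.1, h.symm⟩, fun ⟨c, h⟩ ↦ by rw [← h]⟩
  rw [h, Finset.card_image_of_injective _ fun a b hab ↦ (Prod.ext_iff.1 hab).1, Finset.card_univ]

open Classical in
/-- A second-moment bound: the numbers of neighbours in `S` of the points of the plane vary little,
so they cannot vanish on a large set, in particular not on `S` itself. -/
theorem card_sq_le_of_independent (h2 : (2 : F) ≠ 0) (S : Finset (F × F))
    (hS : ∀ s ∈ S, ∀ t ∈ S, ¬PlaneRel s t) : S.card ^ 2 ≤ Fintype.card F ^ 3 := by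
  rcases S.eq_empty_or_nonempty with rfl | hne
  · simp
  set q : ℝ := (Fintype.card F : ℝ) with hq
  set σ : ℝ := (S.card : ℝ) with hσ
  have hσ0 : 0 < σ := by
    rw [hσ]
    exact_mod_cast hne.card_pos
  let χ : F × F → F × F → ℝ := fun s v ↦ if PlaneRel s v then 1 else 0
  have hrow : ∀ s, ∑ v, χ s v = q := fun s ↦ by
    simp only [χ, Finset.sum_boole, card_planeRel, hq]
  have hsum : ∑ v, ∑ s ∈ S, χ s v = q * σ := by
    rw [Finset.sum_comm, Finset.sum_congr rfl fun s _ ↦ hrow s, Finset.sum_const, nsmul_eq_mul,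
      mul_comm]
  have hcodeg : ∀ s t, ∑ v, χ s v * χ t v ≤ if s = t then q + 1 else 1 := by
    intro s t
    have h1 : ∀ v, χ s v * χ t v = if PlaneRel s v ∧ PlaneRel t v then 1 else 0 := by
      intro v
      simp only [χ, ite_and]
      split_ifs <;> simp
    simp only [h1, Finset.sum_boole]
    split_ifs with hst
    · subst hst
      simp only [and_self, card_planeRel, ← hq]
      linarith
    · have : (Finset.univ.filter fun v ↦ PlaneRel s v ∧ PlaneRel t v).card ≤ 1 := by
        refine Finset.card_le_one.2 fun u hu v hv ↦ ?_
        rw [Finset.mem_filter] at hu hv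
        exact eq_of_planeRel h2 hst hu.2.1 hu.2.2 hv.2.1 hv.2.2
      exact_mod_cast this
  have hsq : ∑ v, (∑ s ∈ S, χ s v) ^ 2 ≤ q * σ + σ ^ 2 := by
    calc ∑ v, (∑ s ∈ S, χ s v) ^ 2 = ∑ s ∈ S, ∑ t ∈ S, ∑ v, χ s v * χ t v := by
          simp only [sq, Finset.sum_mul_sum]
          rw [Finset.sum_comm]
          refine Finset.sum_congr rfl fun s _ ↦ Finset.sum_comm
      _ ≤ ∑ s ∈ S, ∑ t ∈ S, if s = t then q + 1 else 1 :=
          Finset.sum_le_sum fun s _ ↦ Finset.sum_le_sum fun t _ ↦ hcodeg s t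
      _ = ∑ s ∈ S, ∑ t ∈ S, ((if s = t then q else 0) + 1) := by
          refine Finset.sum_congr rfl fun s _ ↦ Finset.sum_congr rfl fun t _ ↦ ?_
          split_ifs <;> simp
      _ = q * σ + σ ^ 2 := by
          simp only [Finset.sum_add_distrib, Finset.sum_ite_eq, Finset.sum_const, nsmul_eq_mul,
            ← hσ]
          rw [← Finset.sum_filter, Finset.filter_true_of_mem (fun _ h ↦ h), Finset.sum_const,
            nsmul_eq_mul, ← hσ]
          ring
  have hzero : ∀ v ∈ S, ∑ s ∈ S, χ s v = 0 := fun v hv ↦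
    Finset.sum_eq_zero fun s hs ↦ if_neg (hS s hs v hv)
  have hcs : (q * σ) ^ 2 ≤ (q ^ 2 - σ) * (q * σ + σ ^ 2) := by
    have h1 : ∑ v ∈ Sᶜ, ∑ s ∈ S, χ s v = q * σ := by
      rw [← hsum, ← Finset.sum_add_sum_compl S, Finset.sum_eq_zero hzero, zero_add]
    have h3 : ((Sᶜ.card : ℕ) : ℝ) = q ^ 2 - σ := by
      rw [Finset.card_compl, Nat.cast_sub (Finset.card_le_univ _), Fintype.card_prod, hq, hσ]
      push_cast
      ring
    calc (q * σ) ^ 2 ≤ Sᶜ.card * ∑ v ∈ Sᶜ, (∑ s ∈ S, χ s v) ^ 2 := by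
          rw [← h1]
          exact sq_sum_le_card_mul_sum_sq
      _ ≤ Sᶜ.card * ∑ v, (∑ s ∈ S, χ s v) ^ 2 := by
          refine mul_le_mul_of_nonneg_left ?_ (Nat.cast_nonneg _)
          exact Finset.sum_le_sum_of_subset_of_nonneg (Finset.subset_univ _)
            fun _ _ _ ↦ sq_nonneg _
      _ ≤ (q ^ 2 - σ) * (q * σ + σ ^ 2) := by
          rw [← h3]
          exact mul_le_mul_of_nonneg_left hsq (Nat.cast_nonneg _)
  have h4 : σ ^ 2 ≤ q ^ 3 := by
    have h5 : σ * (σ ^ 2 + σ * q) ≤ σ * q ^ 3 := by linarith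
    have h6 := le_of_mul_le_mul_left h5 hσ0
    have h7 : 0 ≤ σ * q := by positivity
    linarith
  rw [hσ, hq] at h4
  exact_mod_cast h4

end Plane

/-- The points form a grid whose first coordinates run through `0, 1, …` and
whose second coordinates run through `-g, -4g, -9g, …` for a non-square `g`; there are at most
`k < q / 2` of the latter, so they are distinct. -/
theorem exists_injection_neg_snd_nonsquare {q k n : ℕ} [Fact q.Prime]
    (hk : 2 * k < q) (hn : n ≤ q * k) :
    ∃ e : Fin n → ZMod q × ZMod q, Function.Injective e ∧ ∀ i, ¬IsSquare (-(e i).2) := by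
  rcases Nat.eq_zero_or_pos k with rfl | hk0
  · obtain rfl : n = 0 := by omega
    exact ⟨Fin.elim0, fun i ↦ i.elim0, fun i ↦ i.elim0⟩
  obtain ⟨g, hg⟩ := FiniteField.exists_nonsquare (F := ZMod q) (by
    rw [ZMod.ringChar_zmod_n]
    omega)
  have hcast : ∀ {a b : ℕ}, a < q → b < q → (a : ZMod q) = b → a = b := by
    intro a b ha hb hab
    rw [ZMod.natCast_eq_natCast_iff'] at hab
    rwa [Nat.mod_eq_of_lt ha, Nat.mod_eq_of_lt hb] at hab
  have hg0 : g ≠ 0 := by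
    rintro rfl
    exact hg IsSquare.zero
  refine ⟨fun i ↦ ((i / k : ℕ), -(g * ((i % k + 1 : ℕ) : ZMod q) ^ 2)), ?_, ?_⟩
  · intro i j hij
    rw [Prod.ext_iff] at hij
    obtain ⟨h1, h2⟩ := hij
    have hdiv : ∀ i : Fin n, (i : ℕ) / k < q := fun i ↦
      Nat.div_lt_of_lt_mul (by rw [mul_comm]; exact i.2.trans_le hn)
    have h3 := hcast (hdiv i) (hdiv j) h1
    have hi := Nat.mod_lt (i : ℕ) hk0
    have hj := Nat.mod_lt (j : ℕ) hk0
    have h4 := sq_eq_sq_iff_eq_or_eq_neg.1 (mul_left_cancel₀ hg0 (neg_injective h2))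
    have h5 : (i : ℕ) % k = (j : ℕ) % k := by
      rcases h4 with h | h
      · have := hcast (by omega) (by omega) h
        omega
      · rw [eq_neg_iff_add_eq_zero, ← Nat.cast_add] at h
        have := hcast (a := i % k + 1 + (j % k + 1)) (b := 0) (by omega) (by omega)
          (by rw [h, Nat.cast_zero])
        omega
    refine Fin.ext ?_
    rw [← Nat.div_add_mod (i : ℕ) k, ← Nat.div_add_mod (j : ℕ) k, h3, h5]
  · rintro i ⟨r, hr⟩
    have hi := Nat.mod_lt (i : ℕ) hk0
    have hy : ((i % k + 1 : ℕ) : ZMod q) ≠ 0 := fun h ↦ by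
      have := hcast (a := i % k + 1) (b := 0) (by omega) (by omega) (by rw [h, Nat.cast_zero])
      omega
    rw [neg_neg] at hr
    refine hg ⟨r / ((i % k + 1 : ℕ) : ZMod q), ?_⟩
    rw [div_mul_div_comm, ← hr]
    field_simp

/-- For every `n` there is a graph of girth at least five on `n` vertices whose independence number
is `O(n ^ (3 / 4))`: an induced subgraph of the polarity graph over a prime field, on points whose
negated second coordinates are non-squares. A triangle would make a product of three non-squares a
square, and passing to an induced subgraph does not enlarge independent sets. -/
theorem exists_girth_five_graph (n : ℕ) : ∃ H : SimpleGraph (Fin n), H.CliqueFree 3 ∧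
    (∀ a b x y, a ≠ b → H.Adj x a → H.Adj x b → H.Adj y a → H.Adj y b → x = y) ∧
    ∀ S : Finset (Fin n), H.IsIndepSet S → S.card ^ 2 ≤ (4 * (n.sqrt + 1)) ^ 3 := by
  -- Bertrand: a prime `q` between `2 (√n + 1)` and `4 (√n + 1)` leaves room for `n` grid points.
  obtain ⟨q, hq, hlt, hle⟩ := Nat.exists_prime_lt_and_le_two_mul (2 * (n.sqrt + 1)) (by omega)
  have : Fact q.Prime := ⟨hq⟩
  obtain ⟨e, he, hsq⟩ := exists_injection_neg_snd_nonsquare (q := q) (n := n) hlt (by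
    have := Nat.lt_succ_sqrt n
    nlinarith)
  have h2 : (2 : ZMod q) ≠ 0 := by
    intro h
    have h3 : ((2 : ℕ) : ZMod q) = 0 := by exact_mod_cast h
    rw [ZMod.natCast_eq_zero_iff] at h3
    have := Nat.le_of_dvd two_pos h3
    omega
  have hloop : ∀ i, ¬PlaneRel (e i) (e i) := by
    intro i h
    unfold PlaneRel at h
    rw [sub_self, zero_pow two_ne_zero, ← two_mul] at h
    refine hsq i ?_
    rw [(mul_eq_zero.1 h).resolve_left h2, neg_zero]
    exact IsSquare.zero
  let H : SimpleGraph (Fin n) :=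
    { Adj := fun i j ↦ PlaneRel (e i) (e j)
      symm := ⟨fun _ _ h ↦ planeRel_comm.1 h⟩
      loopless := ⟨hloop⟩ }
  have hH : ∀ i j, H.Adj i j ↔ PlaneRel (e i) (e j) := fun _ _ ↦ Iff.rfl
  refine ⟨H, ?_, ?_, ?_⟩
  · intro T hT
    obtain ⟨i, j, k, hij, hik, hjk, -⟩ := SimpleGraph.is3Clique_iff.1 hT
    rw [hH] at hij hik hjk
    have hprod := prod_eq_sq_of_triangle h2 hij hik hjk
    have hχ : ∀ l, quadraticChar (ZMod q) (-(e l).2) = -1 := fun l ↦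
      quadraticChar_neg_one_iff_not_isSquare.2 (hsq l)
    have h3 := congrArg (quadraticChar (ZMod q)) hprod
    rw [map_mul, map_mul, hχ, hχ, hχ, map_pow] at h3
    nlinarith [sq_nonneg (quadraticChar (ZMod q)
      (((e i).1 - (e j).1) * ((e i).1 - (e k).1) * ((e j).1 - (e k).1)))]
  · intro a b x y hab hxa hxb hya hyb
    exact he (eq_of_planeRel h2 (he.ne hab) (planeRel_comm.1 hxa) (planeRel_comm.1 hxb)
      (planeRel_comm.1 hya) (planeRel_comm.1 hyb))
  · intro S hS
    have h3 := card_sq_le_of_independent h2 (S.image e) (by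
      intro s hs t ht
      obtain ⟨i, hi, rfl⟩ := Finset.mem_image.1 hs
      obtain ⟨j, hj, rfl⟩ := Finset.mem_image.1 ht
      by_cases hij : i = j
      · subst hij
        exact hloop i
      · exact hS hi hj hij)
    rw [Finset.card_image_of_injective _ he, ZMod.card] at h3
    refine h3.trans (Nat.pow_le_pow_left ?_ 3)
    omega

/-! ### Joining copies along the Turán graph -/

section Join

variable {n r : ℕ} {H : SimpleGraph (Fin n)}

theorem turanGraph_sup_cliqueFree (hr : 0 < r) (hH : H.CliqueFree 3) :
    (SimpleGraph.turanGraph n r ⊔ H).CliqueFree (2 * r + 1) := by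
  intro T hT
  obtain ⟨c, -, hc⟩ := Finset.exists_lt_card_fiber_of_mul_lt_card_of_maps_to
    (s := T) (t := Finset.range r) (f := fun i : Fin n ↦ (i : ℕ) % r) (n := 2)
    (fun i _ ↦ Finset.mem_range.2 (Nat.mod_lt _ hr))
    (by rw [Finset.card_range, hT.card_eq]; omega)
  obtain ⟨U, hU, hUcard⟩ := Finset.exists_subset_card_eq (Nat.succ_le_of_lt hc)
  refine hH U ⟨fun i hi j hj hij ↦ ?_, hUcard⟩
  have hi' := Finset.mem_filter.1 (hU hi)
  have hj' := Finset.mem_filter.1 (hU hj)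
  have h := hT.isClique hi'.1 hj'.1 hij
  rw [SimpleGraph.sup_adj, SimpleGraph.turanGraph_adj] at h
  exact h.resolve_left fun h ↦ h (hi'.2.trans hj'.2.symm)

/-- A shattered set lies within one part, as some vertex misses it. A vertex missing a point of the
set lies in the same part, so a fourth point would yield two vertices of this part with two common
neighbours in `H`. -/
theorem graphVCDim_turanGraph_sup_le
    (hH : ∀ a b x y, a ≠ b → H.Adj x a → H.Adj x b → H.Adj y a → H.Adj y b → x = y) :
    graphVCDim (SimpleGraph.turanGraph n r ⊔ H) ≤ 3 := by
  refine graphVCDim_le _ _ fun S hS ↦ ?_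
  by_contra! hcard
  obtain ⟨T, hTS, hT⟩ := Finset.exists_subset_card_eq (Nat.succ_le_of_lt hcard)
  obtain ⟨a, b, c, z, hab, hac, haz, hbc, hbz, hcz, rfl⟩ := Finset.card_eq_four.1 hT
  simp only [Finset.insert_subset_iff, Finset.singleton_subset_iff] at hTS
  obtain ⟨ha, hb, hc, hz⟩ := hTS
  simp only [SimpleGraph.sup_adj, SimpleGraph.turanGraph_adj] at hS
  obtain ⟨v, hv⟩ := hS ∅ (Finset.empty_subset S)
  obtain ⟨x, hx⟩ := hS {a, b} (by simp [Finset.insert_subset_iff, ha, hb])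
  obtain ⟨y, hy⟩ := hS {a, b, c} (by simp [Finset.insert_subset_iff, ha, hb, hc])
  have hva := hv a ha
  have hvb := hv b hb
  have hvz := hv z hz
  have hxa := hx a ha
  have hxb := hx b hb
  have hxc := hx c hc
  have hxz := hx z hz
  have hya := hy a ha
  have hyb := hy b hb
  have hyc := hy c hc
  have hyz := hy z hz
  simp only [Finset.notMem_empty, iff_false, not_or, not_not, Finset.mem_insert,
    Finset.mem_singleton, hab, hab.symm, hac.symm, hbc.symm, haz.symm, hbz.symm, hcz.symm,
    or_false, or_true, true_or, iff_true] at hva hvb hvz hxa hxb hxc hxz hya hyb hyc hyz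
  have hxr : (x : ℕ) % r = v % r := hxz.1.trans hvz.1.symm
  have hyr : (y : ℕ) % r = v % r := hyz.1.trans hvz.1.symm
  have hxa' := hxa.resolve_left fun h ↦ h (hxr.trans hva.1)
  have hxb' := hxb.resolve_left fun h ↦ h (hxr.trans hvb.1)
  have hya' := hya.resolve_left fun h ↦ h (hyr.trans hva.1)
  have hyb' := hyb.resolve_left fun h ↦ h (hyr.trans hvb.1)
  obtain rfl := hH a b x y hab hxa' hxb' hya' hyb'
  rcases hyc with h | h
  · exact h hxc.1
  · exact hxc.2 h

theorem le_ncard_edgeSet_turanGraph_sup (hr : 0 < r) :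
    (1 / 2 : ℝ) * (1 - 1 / r) * (n : ℝ) ^ 2 - (r ^ 2 + 1) ≤
      ((SimpleGraph.turanGraph n r ⊔ H).edgeSet.ncard : ℝ) := by
  have h1 : (SimpleGraph.turanGraph n r).edgeFinset.card ≤
      (SimpleGraph.turanGraph n r ⊔ H).edgeSet.ncard := by
    rw [← Set.ncard_coe_finset, SimpleGraph.coe_edgeFinset]
    exact Set.ncard_le_ncard (SimpleGraph.edgeSet_mono le_sup_left) (Set.toFinite _)
  have h2 : (n ^ 2 - (n % r) ^ 2) * (r - 1) <
      2 * r * ((SimpleGraph.turanGraph n r).edgeFinset.card + 1) := by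
    rw [SimpleGraph.card_edgeFinset_turanGraph]
    have := Nat.lt_mul_div_succ ((n ^ 2 - (n % r) ^ 2) * (r - 1)) (b := 2 * r) (by omega)
    refine this.trans_le (Nat.mul_le_mul_left _ ?_)
    omega
  have h3 : (((n ^ 2 - (n % r) ^ 2) * (r - 1) : ℕ) : ℝ) = ((n : ℝ) ^ 2 - ((n % r : ℕ) : ℝ) ^ 2) *
      (r - 1) := by
    rw [Nat.cast_mul, Nat.cast_sub (Nat.pow_le_pow_left (Nat.mod_le n r) 2), Nat.cast_sub hr]
    push_cast
    ring
  have h4 : ((n : ℝ) ^ 2 - ((n % r : ℕ) : ℝ) ^ 2) * (r - 1) <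
      2 * r * ((SimpleGraph.turanGraph n r ⊔ H).edgeSet.ncard + 1) := by
    rw [← h3]
    have h5 := h2.trans_le (Nat.mul_le_mul_left (2 * r) (Nat.add_le_add_right h1 1))
    exact_mod_cast h5
  have hr' : (1 : ℝ) ≤ r := by exact_mod_cast hr
  have h5 : ((n % r : ℕ) : ℝ) ^ 2 ≤ r ^ 2 := by
    have : ((n % r : ℕ) : ℝ) ≤ r := by exact_mod_cast (Nat.mod_lt n hr).le
    gcongr
  have h6 : ((n % r : ℕ) : ℝ) ^ 2 * (r - 1) ≤ r ^ 2 * r := by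
    refine mul_le_mul h5 (by linarith) (by linarith) (by positivity)
  have h7 : 2 * (r : ℝ) * ((1 / 2 : ℝ) * (1 - 1 / r) * (n : ℝ) ^ 2) = (r - 1) * n ^ 2 := by
    field_simp
  refine le_of_mul_le_mul_left (a := 2 * (r : ℝ)) ?_ (by positivity)
  nlinarith [sq_nonneg (r : ℝ)]

end Join

/-! ### Ramsey–Turán numbers -/

theorem Admissible.mono {d s t n : ℕ} {m : ℝ} {G : SimpleGraph (Fin n)} (h : Admissible d s m G)
    (hst : s ≤ t) : Admissible d t m G :=
  ⟨h.cliqueFree.mono hst, h.vcDim_le, h.indepNum_le⟩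

theorem Admissible.ncard_le_RT {d s n : ℕ} {m : ℝ} {G : SimpleGraph (Fin n)}
    (h : Admissible d s m G) : G.edgeSet.ncard ≤ RT d n s m := by
  refine le_csSup ?_ ⟨G, h, rfl⟩
  refine ((Set.finite_range fun G : SimpleGraph (Fin n) ↦ G.edgeSet.ncard).subset ?_).bddAbove
  rintro e ⟨G, -, rfl⟩
  exact ⟨G, rfl⟩

theorem RT_le {d s n : ℕ} {m B : ℝ} (hB : 0 ≤ B)
    (h : ∀ G : SimpleGraph (Fin n), Admissible d s m G → (G.edgeSet.ncard : ℝ) ≤ B) :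
    (RT d n s m : ℝ) ≤ B := by
  refine (Nat.le_floor_iff hB).1 (csSup_le' ?_)
  rintro e ⟨G, hG, rfl⟩
  exact Nat.le_floor (h G hG)

/-- An independence number `o(n)` eventually excludes the linear-sized independent set, so the
Turán density bounds the number of edges. -/
theorem eventually_RT_le (d : ℕ) {r s : ℕ} (hr : 0 < r) (hs : s ≤ 2 * (r + 1)) (f : ℕ → ℝ)
    (hf : f =o[atTop] fun n : ℕ ↦ (n : ℝ)) {ε : ℝ} (hε : 0 < ε) :
    ∀ᶠ n : ℕ in atTop,
      (RT d n s (f n) : ℝ) ≤ (1 / 2 : ℝ) * (1 - 1 / r) * (n : ℝ) ^ 2 + ε * (n : ℝ) ^ 2 := by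
  obtain ⟨γ, hγ, h⟩ := exists_linear_isIndepSet d hr (ε := 2 * ε) (by linarith)
  filter_upwards [hf.bound (half_pos hγ), eventually_gt_atTop 0] with n hn hn0
  have hn0' : (0 : ℝ) < n := by exact_mod_cast hn0
  have hr' : 1 / (r : ℝ) ≤ 1 := by
    rw [div_le_one (by exact_mod_cast hr)]
    exact_mod_cast hr
  have h0 : 0 ≤ 1 - 1 / (r : ℝ) := by linarith
  refine RT_le (by positivity) fun G hG ↦ ?_
  by_contra! hlt
  obtain ⟨I, hI, hIcard⟩ := h (Fin n) G hG.vcDim_le (hG.cliqueFree.mono hs) (by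
    rw [Fintype.card_fin]
    linarith)
  have h1 : (I.card : ℝ) ≤ G.indepNum := by exact_mod_cast hI.card_le_indepNum
  have h2 := hG.indepNum_le
  rw [Fintype.card_fin] at hIcard
  rw [Real.norm_of_nonneg hn0'.le] at hn
  have h3 := (Real.le_norm_self _).trans hn
  nlinarith

theorem le_rpow_of_sq_le {n k : ℕ} (hkn : k ≤ n) (h : k ^ 2 ≤ (4 * (n.sqrt + 1)) ^ 3) :
    (k : ℝ) ≤ 23 * (n : ℝ) ^ (3 / 4 : ℝ) := by
  rcases Nat.eq_zero_or_pos n with rfl | hn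
  · obtain rfl : k = 0 := by omega
    simp
  have hn1 : (1 : ℝ) ≤ n := by exact_mod_cast hn
  have h1 : (n.sqrt : ℝ) ≤ (n : ℝ) ^ (1 / 2 : ℝ) := by
    rw [← Real.sqrt_eq_rpow]
    exact Real.nat_sqrt_le_real_sqrt
  have h2 : (1 : ℝ) ≤ (n : ℝ) ^ (1 / 2 : ℝ) := Real.one_le_rpow hn1 (by norm_num)
  have h3 : (k : ℝ) ^ 2 ≤ (4 * ((n.sqrt : ℝ) + 1)) ^ 3 := by exact_mod_cast h
  have h4 : (4 * ((n.sqrt : ℝ) + 1)) ^ 3 ≤ (8 * (n : ℝ) ^ (1 / 2 : ℝ)) ^ 3 :=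
    pow_le_pow_left₀ (by positivity) (by linarith) 3
  have h5 : ((n : ℝ) ^ (1 / 2 : ℝ)) ^ 3 = ((n : ℝ) ^ (3 / 4 : ℝ)) ^ 2 := by
    rw [← Real.rpow_natCast, ← Real.rpow_natCast, ← Real.rpow_mul (by positivity),
      ← Real.rpow_mul (by positivity)]
    norm_num
  refine le_of_sq_le_sq ?_ (by positivity)
  have h6 : 0 ≤ ((n : ℝ) ^ (3 / 4 : ℝ)) ^ 2 := sq_nonneg _
  rw [mul_pow 8, h5] at h4
  rw [mul_pow]
  linarith

/-- Extremal examples: the Turán graph with `r` parts, with a graph of girth at least five and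
small independence number added inside each part. -/
theorem exists_admissible_join {d r : ℕ} (hd : 3 ≤ d) (hr : 0 < r) (n : ℕ) :
    ∃ G : SimpleGraph (Fin n), Admissible d (2 * r + 1) (23 * (n : ℝ) ^ (3 / 4 : ℝ)) G ∧
      (1 / 2 : ℝ) * (1 - 1 / r) * (n : ℝ) ^ 2 - (r ^ 2 + 1) ≤ (G.edgeSet.ncard : ℝ) := by
  obtain ⟨H, h3, h4, hind⟩ := exists_girth_five_graph n
  refine ⟨SimpleGraph.turanGraph n r ⊔ H, ⟨turanGraph_sup_cliqueFree hr h3,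
    (graphVCDim_turanGraph_sup_le h4).trans hd, ?_⟩, le_ncard_edgeSet_turanGraph_sup hr⟩
  obtain ⟨S, hS⟩ := (SimpleGraph.turanGraph n r ⊔ H).exists_isNIndepSet_indepNum
  have hSH : H.IsIndepSet S := fun i hi j hj hij hadj ↦
    hS.isIndepSet hi hj hij (Or.inr hadj)
  rw [← hS.card_eq]
  refine le_rpow_of_sq_le ?_ (hind S hSH)
  exact (Finset.card_le_univ S).trans_eq (Fintype.card_fin n)

theorem rtLittleOEq_of_le {d r s : ℕ} (hd : 3 ≤ d) (hr : 0 < r) (hs1 : 2 * r + 1 ≤ s)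
    (hs2 : s ≤ 2 * (r + 1)) :
    RTLittleOEq d s fun n : ℕ ↦ (1 / 2 : ℝ) * (1 - 1 / r) * (n : ℝ) ^ 2 := by
  have hf : (fun n : ℕ ↦ 23 * (n : ℝ) ^ (3 / 4 : ℝ)) =o[atTop] fun n : ℕ ↦ (n : ℝ) := by
    have h : (fun x : ℝ ↦ x ^ (3 / 4 : ℝ)) =o[atTop] fun x : ℝ ↦ x := by
      refine isLittleO_of_tendsto' ((eventually_gt_atTop 0).mono fun x hx h ↦ absurd h hx.ne') ?_
      refine (tendsto_rpow_neg_atTop (y := 1 / 4) (by norm_num)).congr' ?_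
      filter_upwards [eventually_gt_atTop 0] with x hx
      rw [← Real.rpow_sub_one hx.ne']
      norm_num
    simpa [Function.comp_def] using
      (h.comp_tendsto (tendsto_natCast_atTop_atTop (R := ℝ))).const_mul_left 23
  refine ⟨fun f hf ε hε ↦ eventually_RT_le d hr hs2 f hf hε,
    fun n ↦ 23 * (n : ℝ) ^ (3 / 4 : ℝ), hf, isLittleO_iff.2 fun ε hε ↦ ?_⟩
  have hlarge : ∀ᶠ n : ℕ in atTop, ((r : ℝ) ^ 2 + 1) / ε ≤ n :=
    tendsto_natCast_atTop_atTop.eventually_ge_atTop _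
  filter_upwards [eventually_RT_le d hr hs2 _ hf hε, hlarge, eventually_ge_atTop 1]
    with n hup hn hn1
  have hn1' : (1 : ℝ) ≤ n := by exact_mod_cast hn1
  obtain ⟨G, hG, hedges⟩ := exists_admissible_join hd hr n
  have hlow : (G.edgeSet.ncard : ℝ) ≤ RT d n s (23 * (n : ℝ) ^ (3 / 4 : ℝ)) := by
    exact_mod_cast (hG.mono hs1).ncard_le_RT
  rw [div_le_iff₀ hε] at hn
  have h1 : (n : ℝ) * ε ≤ ε * (n : ℝ) ^ 2 := by nlinarith
  rw [Real.norm_eq_abs, Real.norm_of_nonneg (by positivity : (0 : ℝ) ≤ (n : ℝ) ^ 2), abs_le]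
  constructor <;> linarith

end RamseyTuran


theorem theorem5 (d p : ℕ) (hd : 4 ≤ d) (hp : 3 ≤ p) :
    RamseyTuran.RTLittleOEq d (2 * p - 1)
      (fun n : ℕ => (1 / 2 : ℝ) * (1 - 1 / ((p : ℝ) - 1)) * (n : ℝ) ^ 2) ∧
    RamseyTuran.RTLittleOEq d (2 * p)
      (fun n : ℕ => (1 / 2 : ℝ) * (1 - 1 / ((p : ℝ) - 1)) * (n : ℝ) ^ 2) ∧
    (∀ ε : ℝ, 0 < ε → ∃ γ : ℝ, 0 < γ ∧
      ∀ (n : ℕ) (G : SimpleGraph (Fin n)),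
        RamseyTuran.graphVCDim G ≤ d → G.CliqueFree (2 * p) →
        (1 / 2 : ℝ) * (1 - 1 / ((p : ℝ) - 1) + ε) * (n : ℝ) ^ 2 < (G.edgeSet.ncard : ℝ) →
        ∃ I : Finset (Fin n), G.IsIndepSet (I : Set (Fin n)) ∧ γ * (n : ℝ) ≤ (I.card : ℝ)) := by
  obtain ⟨r, rfl⟩ : ∃ r, p = r + 1 := ⟨p - 1, by omega⟩
  have hcast : ((r + 1 : ℕ) : ℝ) - 1 = r := by push_cast; ring
  rw [hcast]
  refine ⟨RamseyTuran.rtLittleOEq_of_le (by omega) (by omega) (by omega) (by omega),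
    RamseyTuran.rtLittleOEq_of_le (by omega) (by omega) (by omega) (by omega), fun ε hε ↦ ?_⟩
  obtain ⟨γ, hγ, h⟩ := RamseyTuran.exists_linear_isIndepSet d (r := r) (by omega) hε
  refine ⟨γ, hγ, fun n G hvc hfree hedges ↦ ?_⟩
  obtain ⟨I, hI, hcard⟩ := h (Fin n) G hvc hfree (by
    rw [Fintype.card_fin]
    linarith)
  rw [Fintype.card_fin] at hcard
  exact ⟨I, hI, hcard⟩
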